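/- **Proposition 2.2.** For $N\in\mathbb N$ let $\mathcal Q_N=\{-1,1\}^N$, and let $T$ be the adjacency matrix of the Hamming cube, $\langle\sigma|T|\tau\rangle=1$ if $\sigma,\tau\in\mathcal Q_N$ differ in exactly one coordinate and $0$ otherwise. Let $U$ be the Random Energy Model (REM): for each $N$ the values $U(\sigma)$, $\sigma\in\mathcal Q_N$, are independent centred Gaussian random variables of variance $N$, all defined (for all $N$) on one probability space with probability measure $\mathbb P$; the joint law for different $N$ is arbitrary. $U$ also denotes the corresponding diagonal matrix, $U|\sigma\rangle=U(\sigma)|\sigma\rangle$. For $\Gamma\ge 0$, $\lambda>0$ and $\eta>0$ let $$Q_\eta=1_{(\eta N,\infty)}\left[\Gamma T-\lambda U\right]$$ be the spectral projection of the self-adjoint matrix $\Gamma T-\lambda U$ onto energies in $(\eta N,\infty)$. Let $|-\rangle=2^{-N/2}\sum_{\sigma\in\mathcal Q_N}|\sigma\rangle$ be the normalized flat state, and let $\beta_c=\sqrt{2\ln 2}$. Then for all $\lambda,\delta>0$ and $\Gamma\ge0$ with $\lambda\delta>\Gamma$, for $\mathbb P$-almost all realizations of the REM, $$\limsup_{N\to\infty}\frac1N\ln\langle-|Q_{\delta\lambda}|-\rangle\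 \le\ -\begin{cases}\dfrac{\delta^2}{2},&\delta\le\beta_c,\\[1ex] \infty,&\delta>\beta_c,\end{cases}$$ where $\ln 0=-\infty$. -/

import Mathlib

namespace QREM

open MeasureTheory ProbabilityTheory

/-- The Hamming cube `{-1, 1}^N`; the units of `ℤ` are exactly `1` and `-1`. -/
abbrev Cube (N : ℕ) : Type := Fin N → ℤˣ

/-- The transversal field `T`: the adjacency matrix of the Hamming cube, in the canonical
orthonormal basis `|σ⟩` of `⊗_{j=1}^N ℂ²`. -/
def transversalField (N : ℕ) : Matrix (Cube N) (Cube N) ℂ :=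
  Matrix.of fun σ τ => if hammingDist σ τ = 1 then 1 else 0

/-- The Hamiltonian `Γ T - lam U`, where `U` acts by multiplication. -/
noncomputable def hamiltonian {N : ℕ} (Γ lam : ℝ) (U : Cube N → ℝ) :
    Matrix (Cube N) (Cube N) ℂ :=
  (Γ : ℂ) • transversalField N - (lam : ℂ) • Matrix.diagonal fun σ => (U σ : ℂ)

/-- The Hamiltonian is self-adjoint, so that its functional calculus is the genuine one. -/
theorem hamiltonian_isSelfAdjoint {N : ℕ} (Γ lam : ℝ) (U : Cube N → ℝ) :
    IsSelfAdjoint (hamiltonian Γ lam U) := by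
  change Matrix.conjTranspose _ = _
  ext σ τ
  by_cases h : σ = τ
  · subst h
    simp [hamiltonian, transversalField, Matrix.conjTranspose_apply]
  · have h' : ¬ τ = σ := fun e => h e.symm
    simp only [hamiltonian, transversalField, Matrix.conjTranspose_apply, Matrix.sub_apply,
      Matrix.smul_apply, Matrix.of_apply, Matrix.diagonal_apply, h, h', if_false,
      hammingDist_comm τ σ]
    split_ifs <;> simp

/-- The spectral projection `Q_δ = 1_{(δN, ∞)}[Γ T - lam U]`, by functional calculus.
(The spectrum is finite, so the indicator function is continuous on it.) -/
noncomputable def spectralProjection {N : ℕ} (Γ lam : ℝ) (U : Cube N → ℝ) (δ : ℝ) :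
    Matrix (Cube N) (Cube N) ℂ :=
  cfc (Set.indicator (Set.Ioi (δ * (N : ℝ))) (fun _ : ℝ => (1 : ℝ))) (hamiltonian Γ lam U)

/-- The normalized flat vector `|-⟩ = 2^{-N/2} ∑_σ |σ⟩`. -/
noncomputable def flatVector (N : ℕ) : Cube N → ℂ :=
  fun _ => ((1 / Real.sqrt ((2 : ℝ) ^ N) : ℝ) : ℂ)

/-- The matrix element `⟨-| A |-⟩`; it is real for the self-adjoint `A` to which it is applied,
and the real part only serves to view it as a real number. -/
noncomputable def flatExpectation {N : ℕ} (A : Matrix (Cube N) (Cube N) ℂ) : ℝ :=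
  (star (flatVector N) ⬝ᵥ A.mulVec (flatVector N)).re

/-- The logarithm of a nonnegative real number, with `ln 0 = -∞`. -/
noncomputable def extLog (x : ℝ) : EReal := ENNReal.log (ENNReal.ofReal x)

/-- The critical inverse temperature `β_c = √(2 ln 2)`. -/
noncomputable def betaC : ℝ := Real.sqrt (2 * Real.log 2)

/-- `U` is a realization, on one probability space, of the Random Energy Models of all sizes:
for each `N` the energies `U N σ`, `σ ∈ {-1,1}^N`, are independent centred Gaussian variables of
variance `N`. Nothing is assumed on the joint law for different `N`. -/
structure IsREM {Ω : Type*} [MeasurableSpace Ω] (P : Measure Ω)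
    (U : (N : ℕ) → Cube N → Ω → ℝ) : Prop where
  hasLaw : ∀ (N : ℕ) (σ : Cube N), HasLaw (U N σ) (gaussianReal 0 (N : NNReal)) P
  indep : ∀ N : ℕ, iIndepFun (U N) P

end QREM

/-! Fix `η < δ` close to `δ` and let `L` be the set of sites with energy at most `-ηN`. The flat
state splits into its restrictions to `L` and to `Lᶜ`. The projection contracts, so the first part
contributes at most `√|L|`, up to normalization. For the second, energies above `δλN` are
classically forbidden off `L`: on the range of the projection `H + s` is at least `E + s`, while off
`L` it acts on a suitable positive weight `φ` with a strictly smaller factor `ρ`. Iterating, each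
step sheds onto `L` an error of order `√|L|`, and these errors form a geometric series
(`norm_projectionAbove_mulVec_le_of_supersolution`). Hence the spectral weight is at most a constant
times `|L| / 2^N`.

The hopping term has norm `ΓN`, so the supersolution needs `λδ > Γ` and sparse moderately deep
sites: almost surely, for large `N`, every site has at most `K` neighbours below `-εN`, with `K`
independent of `N` (`IsREM.ae_eventually_card_neighbors_inter_deepSet_le`). A weight equal to `M` on
those sites and `1` elsewhere then works.

Finally `|L| < 2^N exp(-Nθ)` eventually, for each `θ < η²/2`
(`IsREM.ae_eventually_card_deepSet_lt`). For `δ > β_c` one may take `θ = ln 2`, so `L` is empty and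
the weight is exactly zero. -/

namespace QREM
open MeasureTheory ProbabilityTheory

/-! ### Spectral projections of self-adjoint matrices and supersolutions. -/

section Spectral

variable {ι : Type*} [Fintype ι]

/-- The quadratic form of `Aᴴ * A` is the squared Euclidean norm of `A v`. -/
theorem re_star_dotProduct_mulVec_eq_norm_sq {A B : Matrix ι ι ℂ} (hA : IsSelfAdjoint A)
    (hB : A * A = B) (v : ι → ℂ) :
    (star v ⬝ᵥ B.mulVec v).re = ‖WithLp.toLp 2 (A.mulVec v)‖ ^ 2 := by
  have hA' : A.conjTranspose = A := hA
  have h : star v ⬝ᵥ B.mulVec v = star (A.mulVec v) ⬝ᵥ A.mulVec v := by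
    rw [Matrix.star_mulVec, hA', ← Matrix.dotProduct_mulVec, Matrix.mulVec_mulVec, hB]
  rw [h, EuclideanSpace.norm_sq_eq, dotProduct, Complex.re_sum]
  refine Finset.sum_congr rfl fun i _ => ?_
  simp [Complex.sq_norm, Complex.normSq_apply]

theorem norm_toLp_le_of_support (L : Finset ι) {v : ι → ℂ} {F : ℝ}
    (hF : 0 ≤ F) (hv : ∀ σ ∈ L, ‖v σ‖ ≤ F) (hv0 : ∀ σ ∉ L, v σ = 0) :
    ‖WithLp.toLp 2 v‖ ≤ F * √(L.card) := by
  rw [EuclideanSpace.norm_eq, Real.sqrt_le_left (by positivity), mul_pow,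
    Real.sq_sqrt (by positivity)]
  calc ∑ i, ‖v i‖ ^ 2 = ∑ i ∈ L, ‖v i‖ ^ 2 :=
        (Finset.sum_subset (Finset.subset_univ L) fun x _ hx => by simp [hv0 x hx]).symm
    _ ≤ ∑ i ∈ L, F ^ 2 := Finset.sum_le_sum fun i hi => by
        have := hv i hi
        gcongr
    _ = F ^ 2 * L.card := by simp [mul_comm]

variable [DecidableEq ι]

theorem re_star_dotProduct_cfc_mulVec {H : Matrix ι ι ℂ} (f g : ℝ → ℝ)
    (hfg : ∀ x ∈ spectrum ℝ H, f x * f x = g x) (v : ι → ℂ) :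
    (star v ⬝ᵥ (cfc g H).mulVec v).re = ‖WithLp.toLp 2 ((cfc f H).mulVec v)‖ ^ 2 := by
  have hc : ∀ k : ℝ → ℝ, ContinuousOn k (spectrum ℝ H) := fun k =>
    (Matrix.finite_real_spectrum).continuousOn k
  refine re_star_dotProduct_mulVec_eq_norm_sq (cfc_predicate f H) ?_ v
  rw [← cfc_mul f f H (hc _) (hc _)]
  exact cfc_congr hfg

/-- The difference of the squared norms is the quadratic form of `g² - f²`, which is nonnegative on
the spectrum and so is itself the square of a real function of `H`. Continuity is free because the
spectrum is finite. -/
theorem norm_cfc_mulVec_le_norm_cfc_mulVec {H : Matrix ι ι ℂ} (f g : ℝ → ℝ)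
    (hfg : ∀ x ∈ spectrum ℝ H, |f x| ≤ |g x|) (v : ι → ℂ) :
    ‖WithLp.toLp 2 ((cfc f H).mulVec v)‖ ≤ ‖WithLp.toLp 2 ((cfc g H).mulVec v)‖ := by
  have hc : ∀ k : ℝ → ℝ, ContinuousOn k (spectrum ℝ H) := fun k =>
    (Matrix.finite_real_spectrum).continuousOn k
  have h1 := re_star_dotProduct_cfc_mulVec (H := H) f (fun x => f x * f x) (fun _ _ => rfl) v
  have h2 := re_star_dotProduct_cfc_mulVec (H := H) g (fun x => g x * g x) (fun _ _ => rfl) v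
  have h3 := re_star_dotProduct_cfc_mulVec (H := H) (fun x => √(g x * g x - f x * f x))
    (fun x => g x * g x - f x * f x)
    (fun x hx => Real.mul_self_sqrt (by
      have := mul_self_le_mul_self (abs_nonneg _) (hfg x hx)
      simp only [abs_mul_abs_self] at this
      linarith)) v
  rw [cfc_sub (fun x => g x * g x) (fun x => f x * f x) H (hc _) (hc _), Matrix.sub_mulVec,
    dotProduct_sub, Complex.sub_re, h1, h2] at h3
  refine (abs_le_of_sq_le_sq' ?_ (norm_nonneg _)).2
  rw [← sub_nonneg, h3]
  positivity

variable {H : Matrix ι ι ℂ} {E s : ℝ}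

/-- The spectral projection of `H` onto energies in `(E, ∞)`. -/
noncomputable abbrev projectionAbove (E : ℝ) (H : Matrix ι ι ℂ) : Matrix ι ι ℂ :=
  cfc (Set.indicator (Set.Ioi E) (fun _ : ℝ => (1 : ℝ))) H

theorem norm_projectionAbove_mulVec_le (hH : IsSelfAdjoint H) (v : ι → ℂ) :
    ‖WithLp.toLp 2 ((projectionAbove E H).mulVec v)‖ ≤ ‖WithLp.toLp 2 v‖ := by
  have h := norm_cfc_mulVec_le_norm_cfc_mulVec (H := H)
    (Set.indicator (Set.Ioi E) (fun _ : ℝ => (1 : ℝ))) (fun _ => 1) (fun x _ => by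
      by_cases hx : x ∈ Set.Ioi E <;> simp [hx]) v
  rwa [cfc_const_one ℝ H hH, Matrix.one_mulVec] at h

/-- On the range of the spectral projection onto `(E, ∞)`, the operator `H + s` is bounded below
by `E + s`. -/
theorem mul_norm_projectionAbove_mulVec_le (hH : IsSelfAdjoint H) (hE : 0 < E + s) (v : ι → ℂ) :
    (E + s) * ‖WithLp.toLp 2 ((projectionAbove E H).mulVec v)‖ ≤
      ‖WithLp.toLp 2 ((projectionAbove E H).mulVec ((H + (s : ℂ) • 1).mulVec v))‖ := by
  have hc : ∀ k : ℝ → ℝ, ContinuousOn k (spectrum ℝ H) := fun k =>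
    (Matrix.finite_real_spectrum).continuousOn k
  have hs : H + (s : ℂ) • 1 = cfc (fun x : ℝ => x + s) H := by
    rw [cfc_add_const s (fun x : ℝ => x) H (hc _) hH, cfc_id' ℝ H hH]
    congr 1
    ext i j
    simp [Matrix.algebraMap_matrix_apply, Matrix.one_apply]
  have h := norm_cfc_mulVec_le_norm_cfc_mulVec (H := H)
    (fun x => (E + s) * Set.indicator (Set.Ioi E) (fun _ : ℝ => (1 : ℝ)) x)
    (fun x => Set.indicator (Set.Ioi E) (fun _ : ℝ => (1 : ℝ)) x * (x + s)) (fun x _ => by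
      by_cases hx : x ∈ Set.Ioi E
      · have hx' : E < x := hx
        simp only [hx, Set.indicator_of_mem, mul_one, one_mul]
        rw [abs_of_pos hE, abs_of_pos (by linarith)]; linarith
      · simp [hx]) v
  rw [cfc_const_mul _ _ H (hc _), cfc_mul _ _ H (hc _) (hc _), ← hs, ← Matrix.mulVec_mulVec,
    Matrix.smul_mulVec, WithLp.toLp_smul, norm_smul, Real.norm_eq_abs, abs_of_pos hE] at h
  exact h

/-- If `φ` is a supersolution for `H + s` off `L` at level `ρ < E + s`, the spectral projection
onto `(E, ∞)` is small on functions supported off `L` and dominated by `φ`. -/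
theorem norm_projectionAbove_mulVec_le_of_supersolution (hH : IsSelfAdjoint H) (L : Finset ι)
    {φ : ι → ℝ} {ρ F : ℝ} (hρ : 0 ≤ ρ) (hρE : ρ < E + s) (hF : 0 ≤ F)
    (hφ : ∀ σ ∉ L, ∑ τ, ‖(H + (s : ℂ) • (1 : Matrix ι ι ℂ)) σ τ‖ * φ τ ≤ ρ * φ σ)
    (hL : ∀ σ ∈ L, ∑ τ ∈ Lᶜ, ‖(H + (s : ℂ) • (1 : Matrix ι ι ℂ)) σ τ‖ * φ τ ≤ F)
    {g : ι → ℂ} (hg : ∀ σ, ‖g σ‖ ≤ φ σ) (hg0 : ∀ σ ∈ L, g σ = 0) :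
    ‖WithLp.toLp 2 ((projectionAbove E H).mulVec g)‖ ≤ F * √(L.card) / (E + s - ρ) := by
  have hE : 0 < E + s := lt_of_le_of_lt hρ hρE
  have hd : 0 < E + s - ρ := by linarith
  have hφ0 : ∀ σ, 0 ≤ φ σ := fun σ => (norm_nonneg _).trans (hg σ)
  set D := F * √(L.card) / (E + s - ρ) with hD
  set C := ‖WithLp.toLp 2 (fun σ => (φ σ : ℂ))‖ with hC
  -- After `n` iterations the crude bound `C` survives only with factor `(ρ / (E + s)) ^ n`. The
  -- scale `t` is quantified because each iteration replaces `t` by `t * ρ`.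
  have key : ∀ n : ℕ, ∀ t : ℝ, 0 ≤ t → ∀ g : ι → ℂ, (∀ σ, ‖g σ‖ ≤ t * φ σ) →
      (∀ σ ∈ L, g σ = 0) →
      ‖WithLp.toLp 2 ((projectionAbove E H).mulVec g)‖ ≤ t * (D + (ρ / (E + s)) ^ n * C) := by
    intro n
    induction n with
    | zero =>
      intro t ht g hg hg0
      have h1 : ‖WithLp.toLp 2 g‖ ≤ t * C := by
        have : t * C = ‖WithLp.toLp 2 (fun σ => ((t * φ σ : ℝ) : ℂ))‖ := by
          have h2 : (fun σ => ((t * φ σ : ℝ) : ℂ)) = (t : ℂ) • fun σ => (φ σ : ℂ) := by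
            ext σ; simp
          rw [h2, WithLp.toLp_smul, norm_smul, Complex.norm_real, Real.norm_of_nonneg ht]
        rw [this, EuclideanSpace.norm_eq, EuclideanSpace.norm_eq]
        refine Real.sqrt_le_sqrt (Finset.sum_le_sum fun σ _ => ?_)
        have h3 : ‖((t * φ σ : ℝ) : ℂ)‖ = t * φ σ := by
          rw [Complex.norm_real, Real.norm_of_nonneg (mul_nonneg ht (hφ0 σ))]
        change ‖g σ‖ ^ 2 ≤ ‖((t * φ σ : ℝ) : ℂ)‖ ^ 2
        rw [h3]
        have := hg σ
        gcongr
      have hD0 : 0 ≤ D := by positivity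
      have := norm_projectionAbove_mulVec_le (E := E) hH g
      nlinarith [mul_nonneg ht hD0]
    | succ n ih =>
      intro t ht g hg hg0
      set h := (H + (s : ℂ) • (1 : Matrix ι ι ℂ)).mulVec g with hh
      set h₁ : ι → ℂ := fun σ => if σ ∈ L then h σ else 0 with hh₁
      set h₂ : ι → ℂ := fun σ => if σ ∈ L then 0 else h σ with hh₂
      have hsum : h = h₁ + h₂ := by
        ext σ
        by_cases hσ : σ ∈ L <;> simp [hh₁, hh₂, hσ]
      have hb : ∀ σ, ‖h σ‖ ≤ t * ∑ τ ∈ Lᶜ, ‖(H + (s : ℂ) • (1 : Matrix ι ι ℂ)) σ τ‖ * φ τ := by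
        intro σ
        have : h σ = ∑ τ ∈ Lᶜ, (H + (s : ℂ) • (1 : Matrix ι ι ℂ)) σ τ * g τ := by
          rw [hh, Matrix.mulVec, dotProduct]
          refine (Finset.sum_subset (Finset.subset_univ _) fun x _ hx => ?_).symm
          rw [hg0 x (by simpa using hx), mul_zero]
        rw [this, Finset.mul_sum]
        refine norm_sum_le_of_le _ fun τ _ => ?_
        rw [norm_mul]
        nlinarith [hg τ, norm_nonneg ((H + (s : ℂ) • (1 : Matrix ι ι ℂ)) σ τ)]
      have b1 : ‖WithLp.toLp 2 ((projectionAbove E H).mulVec h₁)‖ ≤ t * F * √(L.card) := by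
        refine (norm_projectionAbove_mulVec_le hH h₁).trans
          (norm_toLp_le_of_support L (mul_nonneg ht hF) (fun σ hσ => ?_) (fun σ hσ => ?_))
        · simp only [hh₁, hσ, if_true]
          exact (hb σ).trans (mul_le_mul_of_nonneg_left (hL σ hσ) ht)
        · simp [hh₁, hσ]
      have b2 : ‖WithLp.toLp 2 ((projectionAbove E H).mulVec h₂)‖ ≤
          (t * ρ) * (D + (ρ / (E + s)) ^ n * C) := by
        refine ih (t * ρ) (mul_nonneg ht hρ) h₂ (fun σ => ?_) (fun σ hσ => by simp [hh₂, hσ])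
        by_cases hσ : σ ∈ L
        · simp only [hh₂, hσ, if_true, norm_zero]
          exact mul_nonneg (mul_nonneg ht hρ) (hφ0 σ)
        · simp only [hh₂, hσ, if_false]
          rw [mul_assoc]
          refine (hb σ).trans (mul_le_mul_of_nonneg_left (le_trans ?_ (hφ σ hσ)) ht)
          exact Finset.sum_le_sum_of_subset_of_nonneg (Finset.subset_univ _)
            fun τ _ _ => mul_nonneg (norm_nonneg _) (hφ0 τ)
      have b3 := mul_norm_projectionAbove_mulVec_le (E := E) hH hE g
      rw [← hh, hsum, Matrix.mulVec_add, WithLp.toLp_add] at b3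
      have b4 := b3.trans ((norm_add_le _ _).trans (add_le_add b1 b2))
      rw [← le_div_iff₀' hE] at b4
      refine b4.trans (le_of_eq ?_)
      -- `D` is the fixed point of the recursion: `F√|L| + ρD = (E + s)D`.
      have hDF : F * √(L.card) = D * (E + s - ρ) := by
        rw [hD, div_mul_cancel₀ _ hd.ne']
      rw [mul_assoc t F, hDF, pow_succ]
      field_simp
      ring
  have hlim : Filter.Tendsto (fun n : ℕ => 1 * (D + (ρ / (E + s)) ^ n * C)) Filter.atTop
      (nhds (1 * (D + 0 * C))) :=
    (((tendsto_pow_atTop_nhds_zero_of_lt_one (by positivity)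
      ((div_lt_one hE).2 hρE)).mul_const C).const_add D).const_mul 1
  have := ge_of_tendsto' hlim fun n => key n 1 zero_le_one g (by simpa using hg) hg0
  simpa using this

end Spectral
-- Deterministic bound on the Hamming cube.
section Cube

variable {N : ℕ}

/-- The neighbours of a vertex of the Hamming cube. -/
def neighbors (σ : Cube N) : Finset (Cube N) := Finset.univ.filter fun τ => hammingDist σ τ = 1

/-- The configurations with energy at most `-a N`. -/
noncomputable def deepSet (a : ℝ) (u : Cube N → ℝ) : Finset (Cube N) :=
  Finset.univ.filter fun σ => u σ ≤ -(a * N)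

theorem mem_neighbors {σ τ : Cube N} : τ ∈ neighbors σ ↔ hammingDist σ τ = 1 := by
  simp [neighbors]

theorem mem_deepSet {a : ℝ} {u : Cube N → ℝ} {σ : Cube N} :
    σ ∈ deepSet a u ↔ u σ ≤ -(a * N) := by
  simp [deepSet]

theorem card_neighbors_le (σ : Cube N) : (neighbors σ).card ≤ N := by
  have h : neighbors σ ⊆ Finset.univ.image fun i : Fin N => Function.update σ i (-σ i) := by
    intro τ hτ
    rw [mem_neighbors, hammingDist, Finset.card_eq_one] at hτ
    obtain ⟨i, hi⟩ := hτ
    have hi' : ∀ j, σ j ≠ τ j ↔ j = i := fun j => by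
      rw [← Finset.mem_singleton, ← hi]
      simp
    refine Finset.mem_image.2 ⟨i, Finset.mem_univ _, funext fun j => ?_⟩
    by_cases hj : j = i
    · subst hj
      rw [Function.update_self]
      exact (Int.units_ne_iff_eq_neg.1 ((hi' j).2 rfl).symm).symm
    · rw [Function.update_of_ne hj]
      exact not_not.1 fun h => hj ((hi' j).1 h)
  exact (Finset.card_le_card h).trans (Finset.card_image_le.trans (by simp))

theorem norm_hamiltonian_add_smul_one_apply {Γ lam s : ℝ} (hΓ : 0 ≤ Γ) {u : Cube N → ℝ}
    {σ : Cube N} (hs : lam * u σ ≤ s) (τ : Cube N) :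
    ‖(hamiltonian Γ lam u + (s : ℂ) • (1 : Matrix (Cube N) (Cube N) ℂ)) σ τ‖ =
      (if τ = σ then s - lam * u σ else 0) + Γ * (if τ ∈ neighbors σ then 1 else 0) := by
  by_cases h : τ = σ
  · subst h
    have : (hamiltonian Γ lam u + (s : ℂ) • (1 : Matrix (Cube N) (Cube N) ℂ)) τ τ =
        ((s - lam * u τ : ℝ) : ℂ) := by
      simp [hamiltonian, transversalField]
      ring
    rw [this, Complex.norm_real, Real.norm_of_nonneg (by linarith)]
    simp [mem_neighbors]
  · have h' : ¬ σ = τ := fun e => h e.symm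
    by_cases hd : hammingDist σ τ = 1 <;>
      simp [hamiltonian, transversalField, h, h', mem_neighbors, hd, abs_of_nonneg hΓ]

theorem sum_norm_hamiltonian_add_smul_one_mul {Γ lam s : ℝ} (hΓ : 0 ≤ Γ) {u : Cube N → ℝ}
    {σ : Cube N} (hs : lam * u σ ≤ s) (φ : Cube N → ℝ) :
    ∑ τ, ‖(hamiltonian Γ lam u + (s : ℂ) • (1 : Matrix (Cube N) (Cube N) ℂ)) σ τ‖ * φ τ =
      (s - lam * u σ) * φ σ + Γ * ∑ τ ∈ neighbors σ, φ τ := by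
  simp only [norm_hamiltonian_add_smul_one_apply hΓ hs, add_mul, Finset.sum_add_distrib, ite_mul,
    zero_mul, mul_assoc, one_mul, ← Finset.mul_sum, Finset.sum_ite_eq', Finset.mem_univ, if_true,
    Finset.sum_ite_mem, Finset.univ_inter]

theorem flatExpectation_spectralProjection (Γ lam δ : ℝ) (u : Cube N → ℝ) :
    flatExpectation (spectralProjection Γ lam u δ) =
      ‖WithLp.toLp 2 ((projectionAbove (δ * N) (hamiltonian Γ lam u)).mulVec
        (flatVector N))‖ ^ 2 :=
  re_star_dotProduct_cfc_mulVec _ _ (fun x _ => by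
    by_cases hx : x ∈ Set.Ioi (δ * (N : ℝ)) <;> simp [hx]) _

/-- If every configuration has at most `K` neighbours of energy below `-ε N`, then the spectral
weight of the flat state above `E N` is controlled by the fraction of configurations with energy
below `-η N`. -/
theorem flatExpectation_spectralProjection_le (hN : 0 < N) {Γ lam E η ε M c : ℝ} {K : ℕ}
    {u : Cube N → ℝ} (hΓ : 0 ≤ Γ) (hlam : 0 ≤ lam) (hM : 1 ≤ M) (hε : 0 ≤ ε) (hc : 0 < c)
    (hK : ∀ σ, (neighbors σ ∩ deepSet ε u).card ≤ K)
    (h₁ : (Γ + lam * ε) * N + Γ * M * K ≤ (E - c) * N)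
    (h₂ : Γ * N + Γ * M * K + lam * η * N * M ≤ (E - c) * N * M) :
    flatExpectation (spectralProjection Γ lam u E) ≤
      (1 + Γ * M / c) ^ 2 * ((deepSet η u).card / 2 ^ N) := by
  have hN' : (0 : ℝ) < N := by exact_mod_cast hN
  have hM0 : 0 ≤ M := by linarith
  set L := deepSet η u with hL
  set H := hamiltonian Γ lam u with hH
  -- The shift makes all entries of `H + s` nonnegative, so taking absolute values loses nothing. It
  -- cancels in `E + s - ρ`, so its size is irrelevant.
  obtain ⟨s, hs0, hs⟩ : ∃ s : ℝ, 0 ≤ s ∧ ∀ σ, lam * u σ ≤ s :=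
    ⟨∑ σ, |lam * u σ|, by positivity, fun σ => (le_abs_self _).trans
      (Finset.single_le_sum (f := fun σ => |lam * u σ|) (fun _ _ => abs_nonneg _)
        (Finset.mem_univ σ))⟩
  set φ : Cube N → ℝ := fun σ => if σ ∈ deepSet ε u then M else 1 with hφ
  have hφ1 : ∀ σ, 1 ≤ φ σ := fun σ => by
    simp only [hφ]
    split_ifs <;> linarith
  have hφM : ∀ σ, φ σ ≤ M := fun σ => by
    simp only [hφ]
    split_ifs <;> linarith
  have hsum : ∀ σ, ∑ τ ∈ neighbors σ, φ τ ≤ N + M * K := fun σ => by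
    calc ∑ τ ∈ neighbors σ, φ τ
        ≤ ∑ τ ∈ neighbors σ, (1 + if τ ∈ deepSet ε u then M else 0) := by
          refine Finset.sum_le_sum fun τ _ => ?_
          simp only [hφ]
          split_ifs <;> linarith
      _ = (neighbors σ).card + (neighbors σ ∩ deepSet ε u).card * M := by
          rw [Finset.sum_add_distrib, Finset.sum_ite_mem]
          simp
      _ ≤ N + K * M := by
          gcongr
          · exact card_neighbors_le σ
          · exact hK σ
      _ = N + M * K := by ring
  have hE : 0 ≤ (E - c) * N := le_trans (by positivity) h₁
  have hEs : E * N + s - (s + (E - c) * N) = c * N := by ring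
  have key := norm_projectionAbove_mulVec_le_of_supersolution (E := E * N) (s := s)
    -- The gap is `E N + s - ρ = c N`, so `F` divided by the gap is `Γ M / c`, free of `N`.
    (ρ := s + (E - c) * N) (F := Γ * N * M) (φ := φ) (H := H)
    (g := fun σ => if σ ∈ L then 0 else 1)
    (hamiltonian_isSelfAdjoint Γ lam u) L (by positivity) (by nlinarith) (by positivity)
    (fun σ hσ => by
      rw [sum_norm_hamiltonian_add_smul_one_mul hΓ (hs σ)]
      have hη : -u σ ≤ η * N := by
        rw [hL, mem_deepSet, not_le] at hσ
        linarith
      have h3 := mul_le_mul_of_nonneg_left (hsum σ) hΓ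
      by_cases hd : σ ∈ deepSet ε u
      · simp only [hφ, hd, if_true] at h3 ⊢
        have := mul_le_mul_of_nonneg_right (mul_le_mul_of_nonneg_left hη hlam) hM0
        nlinarith
      · simp only [hφ, hd, if_false] at h3 ⊢
        rw [mem_deepSet, not_le] at hd
        have := mul_le_mul_of_nonneg_left (show -u σ ≤ ε * N by linarith) hlam
        nlinarith)
    (fun σ hσ => by
      calc ∑ τ ∈ Lᶜ, ‖(H + (s : ℂ) • (1 : Matrix (Cube N) (Cube N) ℂ)) σ τ‖ * φ τ
          ≤ ∑ τ ∈ Lᶜ, Γ * (if τ ∈ neighbors σ then M else 0) := by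
            refine Finset.sum_le_sum fun τ hτ => ?_
            have hne : τ ≠ σ := fun h => (Finset.mem_compl.1 hτ) (h ▸ hσ)
            rw [hH, norm_hamiltonian_add_smul_one_apply hΓ (hs σ), if_neg hne, zero_add, mul_assoc]
            refine mul_le_mul_of_nonneg_left ?_ hΓ
            split_ifs
            · simpa using hφM τ
            · simp
        _ ≤ ∑ τ, Γ * (if τ ∈ neighbors σ then M else 0) :=
            Finset.sum_le_sum_of_subset_of_nonneg (Finset.subset_univ _)
              fun τ _ _ => mul_nonneg hΓ (by split_ifs <;> simp [hM0])
        _ = Γ * ((neighbors σ).card * M) := by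
            rw [← Finset.mul_sum, Finset.sum_ite_mem]
            simp
        _ ≤ Γ * (N * M) := by
            gcongr
            exact card_neighbors_le σ
        _ = Γ * N * M := by ring)
    (fun σ => by
      have := hφ1 σ
      split_ifs
      · simp only [norm_zero]; linarith
      · simpa using this)
    (fun σ hσ => by simp [hσ])
  rw [hEs] at key
  have key2 : ‖WithLp.toLp 2 ((projectionAbove (E * N) H).mulVec
      fun σ => if σ ∈ L then 1 else 0)‖ ≤ 1 * √(L.card) :=
    (norm_projectionAbove_mulVec_le (hamiltonian_isSelfAdjoint Γ lam u) _).trans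
      (norm_toLp_le_of_support L zero_le_one (fun σ hσ => by simp [hσ]) fun σ hσ => by simp [hσ])
  have hflat : flatVector N = ((1 / √((2 : ℝ) ^ N) : ℝ) : ℂ) •
      ((fun σ => if σ ∈ L then (1 : ℂ) else 0) + fun σ => if σ ∈ L then (0 : ℂ) else 1) := by
    ext σ
    by_cases hσ : σ ∈ L <;> simp [flatVector, hσ]
  have hnorm : ‖WithLp.toLp 2 ((projectionAbove (E * N) H).mulVec (flatVector N))‖ ≤
      1 / √((2 : ℝ) ^ N) * ((1 + Γ * M / c) * √(L.card)) := by
    rw [hflat, Matrix.mulVec_smul, Matrix.mulVec_add, WithLp.toLp_smul, WithLp.toLp_add,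
      norm_smul, Complex.norm_real, Real.norm_of_nonneg (by positivity)]
    refine mul_le_mul_of_nonneg_left ?_ (by positivity)
    refine (norm_add_le _ _).trans ((add_le_add key2 key).trans (le_of_eq ?_))
    field_simp
  rw [flatExpectation_spectralProjection]
  refine (pow_le_pow_left₀ (norm_nonneg _) hnorm 2).trans (le_of_eq ?_)
  rw [mul_pow, mul_pow, div_pow, Real.sq_sqrt (by positivity), Real.sq_sqrt (by positivity)]
  ring

end Cube
-- Almost sure estimates for the REM.
section REM

open Filter

variable {Ω : Type*} [MeasurableSpace Ω] {P : Measure Ω}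

/-- First Borel–Cantelli lemma; it needs no assumption on the joint law for different `N`. -/
theorem ae_eventually_notMem_of_measure_le_exp {s : ℕ → Set Ω} {a : ℝ} (ha : a < 0)
    (hs : ∀ N, P (s N) ≤ ENNReal.ofReal (Real.exp (N * a))) :
    ∀ᵐ ω ∂P, ∀ᶠ N in atTop, ω ∉ s N :=
  ae_eventually_notMem (ne_top_of_le_ne_top
    (Real.summable_exp_nat_mul_iff.2 ha).tsum_ofReal_ne_top (ENNReal.tsum_le_tsum hs))

theorem two_pow_eq_exp (N : ℕ) : (2 : ℝ) ^ N = Real.exp (N * Real.log 2) := by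
  rw [Real.exp_nat_mul, Real.exp_log two_pos]

variable [IsProbabilityMeasure P]

theorem measure_le_neg_mul_le {X : Ω → ℝ} {N : ℕ} (hX : HasLaw X (gaussianReal 0 (N : NNReal)) P)
    {a : ℝ} (ha : 0 ≤ a) :
    P {ω | X ω ≤ -(a * N)} ≤ ENNReal.ofReal (Real.exp (-(N * (a ^ 2 / 2)))) := by
  have hint : Integrable (fun ω => Real.exp (-a * X ω)) P := by
    have h := integrable_exp_mul_gaussianReal (μ := 0) (v := (N : NNReal)) (-a)
    rw [← hX.map_eq] at h
    exact h.comp_aemeasurable hX.aemeasurable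
  have h := measure_le_le_exp_mul_mgf (-(a * N)) (neg_nonpos.2 ha) hint
  rw [mgf_gaussianReal hX.map_eq, ← Real.exp_add] at h
  rw [← ofReal_measureReal]
  refine ENNReal.ofReal_le_ofReal (h.trans (le_of_eq ?_))
  congr 1
  simp only [NNReal.coe_natCast]
  ring

variable {U : (N : ℕ) → Cube N → Ω → ℝ}

/-- By the Gaussian tail the expected cardinality is at most `2^N exp(-Nη²/2)`; Markov's inequality
and the gap `θ < η²/2` give summable probabilities. -/
theorem IsREM.ae_eventually_card_deepSet_lt (hU : IsREM P U) {η θ : ℝ} (hη : 0 ≤ η)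
    (hθ : θ < η ^ 2 / 2) :
    ∀ᵐ ω ∂P, ∀ᶠ N : ℕ in atTop,
      ((deepSet η fun σ => U N σ ω).card : ℝ) < 2 ^ N * Real.exp (-(N * θ)) := by
  have h := ae_eventually_notMem_of_measure_le_exp (P := P) (a := θ - η ^ 2 / 2)
    (s := fun N => {ω | ENNReal.ofReal (2 ^ N * Real.exp (-(N * θ))) ≤
      ((deepSet η fun σ => U N σ ω).card : ENNReal)}) (by linarith) fun N => by
    have hnull : ∀ σ, NullMeasurableSet {ω | U N σ ω ≤ -(η * N)} P := fun σ =>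
      (hU.hasLaw N σ).aemeasurable.nullMeasurable measurableSet_Iic
    have hcard : (fun ω => ((deepSet η fun σ => U N σ ω).card : ENNReal)) =
        fun ω => ∑ σ, Set.indicator {ω | U N σ ω ≤ -(η * N)} (1 : Ω → ENNReal) ω := by
      ext ω
      simp [deepSet, Set.indicator_apply]
    have hmeas : ∀ σ, AEMeasurable
        (Set.indicator {ω | U N σ ω ≤ -(η * N)} (1 : Ω → ENNReal)) P := fun σ =>
      aemeasurable_one.indicator₀ (hnull σ)
    have hmarkov := mul_meas_ge_le_lintegral₀ (μ := P)
      (f := fun ω => ((deepSet η fun σ => U N σ ω).card : ENNReal))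
      (by rw [hcard]; exact Finset.aemeasurable_fun_sum _ fun σ _ => hmeas σ)
      (ENNReal.ofReal (2 ^ N * Real.exp (-(N * θ))))
    have hint : ∫⁻ ω, ((deepSet η fun σ => U N σ ω).card : ENNReal) ∂P ≤
        ENNReal.ofReal (2 ^ N * Real.exp (-(N * (η ^ 2 / 2)))) := by
      rw [hcard, lintegral_finsetSum' _ fun σ _ => hmeas σ]
      calc ∑ σ, ∫⁻ ω, Set.indicator {ω | U N σ ω ≤ -(η * N)} (1 : Ω → ENNReal) ω ∂P
          ≤ ∑ _σ : Cube N, ENNReal.ofReal (Real.exp (-(N * (η ^ 2 / 2)))) :=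
            Finset.sum_le_sum fun σ _ => by
              rw [lintegral_indicator_one₀ (hnull σ)]
              exact measure_le_neg_mul_le (hU.hasLaw N σ) hη
        _ = _ := by
            rw [ENNReal.ofReal_mul (by positivity)]
            simp [ENNReal.ofReal_pow]
    have hpos : 0 < 2 ^ N * Real.exp (-(N * θ)) := by positivity
    have h2 := hmarkov.trans hint
    rw [mul_comm, ← ENNReal.le_div_iff_mul_le (Or.inl (ENNReal.ofReal_pos.2 hpos).ne')
      (Or.inl ENNReal.ofReal_ne_top), ← ENNReal.ofReal_div_of_pos hpos] at h2
    refine h2.trans (ENNReal.ofReal_le_ofReal (le_of_eq ?_))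
    rw [mul_div_mul_left _ _ (by positivity), ← Real.exp_sub]
    congr 1
    ring
  filter_upwards [h] with ω hω
  filter_upwards [hω] with N hN
  by_contra hlt
  refine hN ?_
  rw [← ENNReal.ofReal_natCast]
  exact ENNReal.ofReal_le_ofReal (not_lt.1 hlt)

/-- Union bound: `2^N` sites and at most `2^N` sets of `K` neighbours each, against the probability
`exp(-NKε²/2)` that independence gives; `hK` makes the product decay. -/
theorem IsREM.ae_eventually_card_neighbors_inter_deepSet_le (hU : IsREM P U) {ε : ℝ} (hε : 0 ≤ ε)
    {K : ℕ} (hK : 2 * Real.log 2 < K * (ε ^ 2 / 2)) :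
    ∀ᵐ ω ∂P, ∀ᶠ N : ℕ in atTop, ∀ σ : Cube N,
      (neighbors σ ∩ deepSet ε fun σ => U N σ ω).card ≤ K := by
  have h := ae_eventually_notMem_of_measure_le_exp (P := P)
    (a := 2 * Real.log 2 - K * (ε ^ 2 / 2))
    (s := fun N => ⋃ σ ∈ (Finset.univ : Finset (Cube N)),
      ⋃ S ∈ (neighbors σ).powersetCard K, ⋂ τ ∈ S, U N τ ⁻¹' Set.Iic (-(ε * N)))
    (by linarith) fun N => by
    calc _ ≤ ∑ σ : Cube N, ∑ S ∈ (neighbors σ).powersetCard K,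
          P (⋂ τ ∈ S, U N τ ⁻¹' Set.Iic (-(ε * N))) :=
          (measure_biUnion_finset_le _ _).trans
            (Finset.sum_le_sum fun σ _ => measure_biUnion_finset_le _ _)
      _ ≤ ∑ σ : Cube N, ∑ S ∈ (neighbors σ).powersetCard K,
          ENNReal.ofReal (Real.exp (-(N * (ε ^ 2 / 2)))) ^ K := by
          refine Finset.sum_le_sum fun σ _ => Finset.sum_le_sum fun S hS => ?_
          rw [(hU.indep N).measure_inter_preimage_eq_mul S fun _ _ => measurableSet_Iic,
            ← (Finset.mem_powersetCard.1 hS).2]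
          exact Finset.prod_le_pow_card _ _ _ fun τ _ =>
            measure_le_neg_mul_le (hU.hasLaw N τ) hε
      _ ≤ ∑ σ : Cube N, (2 : ENNReal) ^ N *
          ENNReal.ofReal (Real.exp (-(N * (ε ^ 2 / 2)))) ^ K := by
          refine Finset.sum_le_sum fun σ _ => ?_
          rw [Finset.sum_const, nsmul_eq_mul, Finset.card_powersetCard]
          gcongr
          have : (neighbors σ).card.choose K ≤ 2 ^ N :=
            (Nat.choose_le_two_pow _ _).trans
              (Nat.pow_le_pow_right two_pos (card_neighbors_le σ))
          exact_mod_cast this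
      _ = ENNReal.ofReal (2 ^ N * (2 ^ N * Real.exp (-(N * (ε ^ 2 / 2))) ^ K)) := by
          rw [ENNReal.ofReal_mul (by positivity), ENNReal.ofReal_mul (by positivity),
            ← ENNReal.ofReal_pow (by positivity)]
          simp [ENNReal.ofReal_pow]
      _ = ENNReal.ofReal (Real.exp (N * (2 * Real.log 2 - K * (ε ^ 2 / 2)))) := by
          rw [two_pow_eq_exp, ← Real.exp_nat_mul, ← Real.exp_add, ← Real.exp_add]
          congr 2
          ring
  filter_upwards [h] with ω hω
  filter_upwards [hω] with N hN σ
  by_contra hlt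
  obtain ⟨S, hS, hSK⟩ := Finset.exists_subset_card_eq (not_le.1 hlt).le
  refine hN ?_
  simp only [Set.mem_iUnion, Set.mem_iInter]
  refine ⟨σ, Finset.mem_univ _, S, Finset.mem_powersetCard.2
    ⟨hS.trans Finset.inter_subset_left, hSK⟩, fun τ hτ => ?_⟩
  exact mem_deepSet.1 (Finset.mem_inter.1 (hS hτ)).2

/-- The count `m` is kept as a natural number so that `m < 1` can later force `m = 0`. -/
theorem IsREM.exists_flatExpectation_spectralProjection_le (hU : IsREM P U) {Γ lam δ θ : ℝ}
    (hlam : 0 < lam) (hΓ : 0 ≤ Γ) (hδ : Γ < lam * δ) (hθ : θ < δ ^ 2 / 2) :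
    ∃ C : ℝ, 0 < C ∧ ∀ᵐ ω ∂P, ∀ᶠ N : ℕ in atTop, ∃ m : ℕ,
      flatExpectation (spectralProjection Γ lam (fun σ => U N σ ω) (δ * lam)) ≤ C * (m / 2 ^ N) ∧
        (m : ℝ) < 2 ^ N * Real.exp (-(N * θ)) := by
  have hδ0 : 0 < δ := pos_of_mul_pos_right (hΓ.trans_lt hδ) hlam.le
  obtain ⟨η, hη0, hηδ, hηθ⟩ : ∃ η, 0 < η ∧ η < δ ∧ θ < η ^ 2 / 2 := by
    have hcont : Tendsto (fun x : ℝ => x ^ 2 / 2) (nhdsWithin δ (Set.Iio δ)) (nhds (δ ^ 2 / 2)) :=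
      ((continuous_pow 2).div_const 2).continuousAt.tendsto.mono_left nhdsWithin_le_nhds
    obtain ⟨η, h, h'⟩ := ((hcont.eventually (lt_mem_nhds hθ)).and
      (Ioo_mem_nhdsLT hδ0)).exists
    exact ⟨η, h'.1, h'.2, h⟩
  set a := lam * (δ - η) with ha
  set b := lam * δ - Γ with hb
  have ha0 : 0 < a := mul_pos hlam (by linarith)
  have hb0 : 0 < b := by linarith
  -- `a` is the margin on deep sites outside `L`, `b` the margin on ordinary sites. With `c = λε =
  -- d/4`, the value of `M` makes `ΓN` at most `dNM/4`, and large `N` makes `ΓMK` at most `dN/2`.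
  set d := min a b with hd
  have hd0 : 0 < d := lt_min ha0 hb0
  have hda : d ≤ a := min_le_left _ _
  have hdb : d ≤ b := min_le_right _ _
  set ε := d / (4 * lam) with hε
  have hε0 : 0 < ε := by positivity
  have hlε : lam * ε = d / 4 := by rw [hε]; field_simp
  set M := 1 + 4 * Γ / d with hM
  have hM1 : 1 ≤ M := by
    have : 0 ≤ 4 * Γ / d := by positivity
    linarith
  have hMd : 4 * Γ ≤ d * M := by
    rw [hM, mul_add, mul_div_cancel₀ _ hd0.ne']
    linarith
  obtain ⟨K, hK⟩ := exists_nat_gt (2 * Real.log 2 / (ε ^ 2 / 2))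
  rw [div_lt_iff₀ (by positivity)] at hK
  refine ⟨(1 + Γ * M / (d / 4)) ^ 2, by positivity, ?_⟩
  filter_upwards [hU.ae_eventually_card_deepSet_lt hη0.le hηθ,
    hU.ae_eventually_card_neighbors_inter_deepSet_le hε0.le hK] with ω h₁ h₂
  have hlarge : ∀ᶠ N : ℕ in atTop, 2 * (Γ * M * K) / d ≤ N :=
    tendsto_natCast_atTop_atTop.eventually_ge_atTop _
  filter_upwards [h₁, h₂, hlarge, eventually_gt_atTop 0] with N h₁ h₂ h₃ hN
  rw [div_le_iff₀ hd0] at h₃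
  have hN' : (0 : ℝ) < N := by exact_mod_cast hN
  refine ⟨_, flatExpectation_spectralProjection_le (η := η) hN hΓ hlam.le hM1 hε0.le
    (by positivity : 0 < d / 4) h₂ ?_ ?_, h₁⟩
  · rw [hlε]
    nlinarith [mul_le_mul_of_nonneg_right hdb hN'.le]
  · have h4 := mul_le_mul_of_nonneg_right hMd hN'.le
    have h5 := mul_le_mul_of_nonneg_right hda (by positivity : 0 ≤ N * M)
    have h6 : (N : ℝ) * d ≤ N * d * M := le_mul_of_one_le_right (by positivity) hM1
    nlinarith

/-! ### Passage to exponential rates. -/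

theorem extLog_mono {x y : ℝ} (h : x ≤ y) : extLog x ≤ extLog y :=
  ENNReal.log_monotone (ENNReal.ofReal_le_ofReal h)

theorem extLog_exp (x : ℝ) : extLog (Real.exp x) = x := by
  rw [extLog, ENNReal.log_ofReal_of_pos (Real.exp_pos x), Real.log_exp]

theorem limsup_extLog_le {x : ℕ → ℝ} {C θ θ' : ℝ} (hC : 0 < C) (hθ : θ < θ')
    (hx : ∀ᶠ N : ℕ in atTop, x N ≤ C * Real.exp (-(N * θ'))) :
    limsup (fun N : ℕ => ((1 / (N : ℝ) : ℝ) : EReal) * extLog (x N)) atTop ≤ ((-θ : ℝ) : EReal) := by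
  refine limsup_le_of_le (by isBoundedDefault) ?_
  -- The slack `θ' - θ` absorbs the constant `C`.
  have hlarge : ∀ᶠ N : ℕ in atTop, Real.log C / (θ' - θ) ≤ N :=
    tendsto_natCast_atTop_atTop.eventually_ge_atTop _
  filter_upwards [hx, hlarge, eventually_gt_atTop 0] with N hx hN hN0
  have hN' : (0 : ℝ) < N := by exact_mod_cast hN0
  rw [div_le_iff₀ (by linarith)] at hN
  have h : x N ≤ Real.exp (N * -θ) := by
    refine hx.trans ?_
    rw [← Real.exp_log hC, ← Real.exp_add, Real.exp_le_exp]
    linarith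
  calc ((1 / (N : ℝ) : ℝ) : EReal) * extLog (x N)
      ≤ ((1 / (N : ℝ) : ℝ) : EReal) * ((N * -θ : ℝ) : EReal) := by
        rw [← extLog_exp (N * -θ)]
        exact mul_le_mul_of_nonneg_left (extLog_mono h)
          (EReal.coe_nonneg.2 (by positivity))
    _ = ((-θ : ℝ) : EReal) := by
        rw [← EReal.coe_mul]
        congr 1
        field_simp

theorem IsREM.ae_limsup_extLog_flatExpectation_le (hU : IsREM P U) {Γ lam δ θ : ℝ}
    (hlam : 0 < lam) (hΓ : 0 ≤ Γ) (hδ : Γ < lam * δ) (hθ : θ < δ ^ 2 / 2) :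
    ∀ᵐ ω ∂P, limsup (fun N : ℕ => ((1 / (N : ℝ) : ℝ) : EReal) *
      extLog (flatExpectation (spectralProjection Γ lam (fun σ => U N σ ω) (δ * lam)))) atTop
        ≤ ((-θ : ℝ) : EReal) := by
  obtain ⟨θ', h₁, h₂⟩ := exists_between hθ
  obtain ⟨C, hC, h⟩ := hU.exists_flatExpectation_spectralProjection_le hlam hΓ hδ h₂
  filter_upwards [h] with ω hω
  refine limsup_extLog_le hC h₁ ?_
  filter_upwards [hω] with N ⟨m, hm, hm'⟩
  refine hm.trans (mul_le_mul_of_nonneg_left ?_ hC.le)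
  rw [div_le_iff₀' (by positivity)]
  exact hm'.le

/-- Above the critical energy density the spectral weight of the flat state eventually vanishes. -/
theorem IsREM.ae_limsup_extLog_flatExpectation_eq_bot (hU : IsREM P U) {Γ lam δ : ℝ}
    (hlam : 0 < lam) (hΓ : 0 ≤ Γ) (hδ : Γ < lam * δ) (hθ : Real.log 2 < δ ^ 2 / 2) :
    ∀ᵐ ω ∂P, limsup (fun N : ℕ => ((1 / (N : ℝ) : ℝ) : EReal) *
      extLog (flatExpectation (spectralProjection Γ lam (fun σ => U N σ ω) (δ * lam)))) atTop
        = ⊥ := by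
  obtain ⟨C, hC, h⟩ := hU.exists_flatExpectation_spectralProjection_le hlam hΓ hδ hθ
  filter_upwards [h] with ω hω
  refine le_bot_iff.1 (limsup_le_of_le (by isBoundedDefault) ?_)
  filter_upwards [hω, eventually_gt_atTop 0] with N ⟨m, hm, hm'⟩ hN0
  have hN' : (0 : ℝ) < N := by exact_mod_cast hN0
  -- At `θ = ln 2` the bound on the count reads `m < 1`.
  rw [two_pow_eq_exp, ← Real.exp_add, add_neg_cancel, Real.exp_zero] at hm'
  have hm0 : m = 0 := Nat.lt_one_iff.1 (by exact_mod_cast hm')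
  rw [hm0, Nat.cast_zero, zero_div, mul_zero] at hm
  rw [extLog, ENNReal.ofReal_eq_zero.2 hm, ENNReal.log_zero,
    EReal.coe_mul_bot_of_pos (by positivity)]

end REM
end QREM

theorem proposition2p2 {Ω : Type*} [MeasurableSpace Ω] (P : MeasureTheory.Measure Ω)
    [MeasureTheory.IsProbabilityMeasure P] (U : (N : ℕ) → QREM.Cube N → Ω → ℝ)
    (hU : QREM.IsREM P U) (Γ lam δ : ℝ) (hlam : 0 < lam) (hΓ : 0 ≤ Γ) (hδ : Γ < lam * δ) :
    ∀ᵐ ω ∂P,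
      Filter.limsup (fun N : ℕ => ((1 / (N : ℝ) : ℝ) : EReal) *
          QREM.extLog (QREM.flatExpectation
            (QREM.spectralProjection Γ lam (fun σ => U N σ ω) (δ * lam)))) Filter.atTop
        ≤ if δ ≤ QREM.betaC then ((-(δ ^ 2 / 2) : ℝ) : EReal) else ⊥ := by
  by_cases h : δ ≤ QREM.betaC
  · simp only [h, if_true]
    -- A countable sequence of rates tending to `δ²/2` keeps a single null set.
    have hall := MeasureTheory.ae_all_iff.2 fun k : ℕ =>
      hU.ae_limsup_extLog_flatExpectation_le (θ := δ ^ 2 / 2 - 1 / ((k : ℝ) + 1)) hlam hΓ hδ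
        (sub_lt_self _ (by positivity))
    filter_upwards [hall] with ω hω
    have hlim : Filter.Tendsto (fun k : ℕ => ((-(δ ^ 2 / 2 - 1 / ((k : ℝ) + 1)) : ℝ) : EReal))
        Filter.atTop (nhds ((-(δ ^ 2 / 2) : ℝ) : EReal)) := by
      refine (continuous_coe_real_ereal.tendsto _).comp ?_
      simpa using (tendsto_one_div_add_atTop_nhds_zero_nat (𝕜 := ℝ)).const_sub (δ ^ 2 / 2) |>.neg
    exact ge_of_tendsto' hlim hω
  · simp only [h, if_false]
    have hlog : Real.log 2 < δ ^ 2 / 2 := by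
      have hδ0 : 0 ≤ δ := (pos_of_mul_pos_right (hΓ.trans_lt hδ) hlam.le).le
      rw [QREM.betaC, not_le, Real.sqrt_lt' (lt_of_le_of_ne hδ0 fun h0 => by
        rw [← h0, mul_zero] at hδ; linarith)] at h
      linarith
    filter_upwards [hU.ae_limsup_extLog_flatExpectation_eq_bot hlam hΓ hδ hlog] with ω hω
    exact hω.le
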